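/- Let $G$ be a compact (Hausdorff) abelian group with normalized Haar measure $\mu$, and let $\hat G$ be its dual group of continuous characters $\chi : G \to \{z \in \mathbb{C} : |z| = 1\}$. A continuous surjective endomorphism $\gamma$ of $G$ preserves $\mu$. It acts on $\hat G$ by $\gamma\chi := \chi\circ\gamma$, and we put $\gamma\hat G := \{\gamma\chi : \chi\in\hat G\}$. Let $T_\gamma$ be the operator $T_\gamma f := f\circ\gamma$ on the complex Hilbert space $L^2(G,\mu)$, and let $\Pi_\gamma$ be its adjoint, i.e. the operator on $L^2(G,\mu)$ such that $\int_G (T_\gamma f)\, g\, d\mu = \int_G f\, (\Pi_\gamma g)\, d\mu$ for all $f, g \in L^2(G,\mu)$. Let $\gamma_1, \gamma_2$ be continuous surjective endomorphisms of $G$ with $\gamma_1\gamma_2 = \gamma_2\gamma_1$, such that $\operatorname{Ker}(\gamma_1)$ is finite. Then the following three conditions are equivalent: 1. $T_{\gamma_2}\Pi_{\gamma_1} = \Pi_{\gamma_1}T_{\gamma_2}$ as operators on $L^2(G,\mu)$; 2. for every $\chi\in\hat G$, if $\gamma_2\chi\in\gamma_1\hat G$, then $\chi\in\gamma_1\hat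 G$; 3. $\operatorname{Ker}(\gamma_1)\cap\operatorname{Ker}(\gamma_2) = \{0\}$. -/

import Mathlib

open MeasureTheory

/-- A surjective continuous endomorphism of a compact group preserves the Haar measure. -/
theorem measurePreserving_of_surjective {G : Type*} [CommGroup G] [TopologicalSpace G]
    [IsTopologicalGroup G] [CompactSpace G] [T2Space G] [MeasurableSpace G] [BorelSpace G]
    (μ : Measure G) [μ.IsHaarMeasure]
    (γ : G →ₜ* G) (hγ : Function.Surjective γ) : MeasurePreserving γ μ μ :=
  MonoidHom.measurePreserving (f := (γ : G →* G)) γ.continuous_toFun hγ rfl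

noncomputable section

/-- The operator `T_γ f = f ∘ γ` of composition by the surjective endomorphism `γ`, on the complex
Hilbert space `L²(G, μ)`, where `μ` is the Haar measure. -/
def compositionOperator {G : Type*} [CommGroup G] [TopologicalSpace G]
    [IsTopologicalGroup G] [CompactSpace G] [T2Space G] [MeasurableSpace G] [BorelSpace G]
    (μ : Measure G) [μ.IsHaarMeasure]
    (γ : G →ₜ* G) (hγ : Function.Surjective γ) : Lp ℂ 2 μ →L[ℂ] Lp ℂ 2 μ :=
  (Lp.compMeasurePreservingₗᵢ ℂ γ
    (measurePreserving_of_surjective μ γ hγ)).toContinuousLinearMap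

/-- The transfer operator `Π_γ` on `L²(G, μ)`: the adjoint of the composition operator `T_γ`. -/
def transferOperator {G : Type*} [CommGroup G] [TopologicalSpace G]
    [IsTopologicalGroup G] [CompactSpace G] [T2Space G] [MeasurableSpace G] [BorelSpace G]
    (μ : Measure G) [μ.IsHaarMeasure]
    (γ : G →ₜ* G) (hγ : Function.Surjective γ) : Lp ℂ 2 μ →L[ℂ] Lp ℂ 2 μ :=
  ContinuousLinearMap.adjoint (compositionOperator μ γ hγ)

/-- The bilinear form of the duality that defines the transfer operator:
`∫ (T_γ f) g dμ = ∫ f (Π_γ g) dμ`. -/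
theorem integral_compositionOperator_mul {G : Type*} [CommGroup G] [TopologicalSpace G]
    [IsTopologicalGroup G] [CompactSpace G] [T2Space G] [MeasurableSpace G] [BorelSpace G]
    (μ : Measure G) [μ.IsHaarMeasure]
    (γ : G →ₜ* G) (hγ : Function.Surjective γ) (f g : Lp ℂ 2 μ) :
    ∫ x, (compositionOperator μ γ hγ f : G → ℂ) x * (g : G → ℂ) x ∂μ =
      ∫ x, (f : G → ℂ) x * (transferOperator μ γ hγ g : G → ℂ) x ∂μ := by
  have hmp := measurePreserving_of_surjective μ γ hγ
  have h := ContinuousLinearMap.adjoint_inner_right (compositionOperator μ γ hγ) (star f) g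
  rw [L2.inner_def, L2.inner_def] at h
  have e1 : ∀ᵐ x ∂μ, (compositionOperator μ γ hγ (star f) : G → ℂ) x =
      star ((compositionOperator μ γ hγ f : G → ℂ) x) := by
    have a : (compositionOperator μ γ hγ (star f) : G → ℂ) =ᵐ[μ] (star f : Lp ℂ 2 μ) ∘ γ :=
      Lp.coeFn_compMeasurePreserving _ hmp
    have b : (compositionOperator μ γ hγ f : G → ℂ) =ᵐ[μ] f ∘ γ :=
      Lp.coeFn_compMeasurePreserving _ hmp
    have c := hmp.quasiMeasurePreserving.ae (Lp.coeFn_star f)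
    filter_upwards [a, b, c] with x ha hb hc
    rw [ha, hb]
    exact hc
  have l : ∫ x, (compositionOperator μ γ hγ f : G → ℂ) x * (g : G → ℂ) x ∂μ =
      ∫ x, inner ℂ ((compositionOperator μ γ hγ (star f) : G → ℂ) x) ((g : G → ℂ) x) ∂μ := by
    refine integral_congr_ae ?_
    filter_upwards [e1] with x hx
    rw [hx]
    simp [mul_comm]
  rw [l, ← h]
  refine integral_congr_ae ?_
  filter_upwards [Lp.coeFn_star f] with x hx
  rw [hx]
  simp [transferOperator, mul_comm]

end

set_option linter.overlappingInstances false
set_option linter.unusedSectionVars false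

/-! With `K = Ker γ₁`, each of the three conditions is equivalent to `K ⊆ γ₂(K)`. Condition 3: `γ₂`
maps the finite group `K` to itself, and there injective means surjective
(`MonoidHom.ker_inf_ker_eq_bot_iff_le_map`). Condition 2: a character lies in `γ₁Ĝ` iff it is
trivial on `K`, so the condition says that characters trivial on `γ₂(K)` are trivial on `K`; since
characters separate points from closed subgroups, this is the inclusion
(`forall_map_mem_range_iff`). Condition 1: `T_{γ₁} Π_{γ₁}` is the average of the translations by `K`
(`sum_translationOperator_ker`). Cancelling injective composition operators turns commutation into
equality of the sums of translations over `k` and over `γ₂ k`, for `k ∈ K`; bump functions detect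
the inclusion.

Separation of points by characters is proved by Gelfand theory, in the commutative C⋆-algebra given
by the bicommutant of the translations on `L²`. -/

noncomputable section

/-! ### Translations and convolutions on `L²(G, μ)` -/

section Translation

variable {G : Type*} [CommGroup G] [TopologicalSpace G] [IsTopologicalGroup G] [CompactSpace G]
  [T2Space G] [MeasurableSpace G] [BorelSpace G] (μ : Measure G) [μ.IsHaarMeasure]

/-- The translation operator `f ↦ f (x * ·)` on `L²(G, μ)`. -/
def translationOperator (x : G) : Lp ℂ 2 μ →L[ℂ] Lp ℂ 2 μ :=
  (Lp.compMeasurePreservingₗᵢ ℂ (x * ·) (measurePreserving_mul_left μ x)).toContinuousLinearMap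

theorem norm_translationOperator_apply (x : G) (f : Lp ℂ 2 μ) :
    ‖translationOperator μ x f‖ = ‖f‖ :=
  (Lp.compMeasurePreservingₗᵢ ℂ (x * ·) (measurePreserving_mul_left μ x)).norm_map f

theorem translationOperator_toLp (x : G) (f : C(G, ℂ)) :
    translationOperator μ x (ContinuousMap.toLp 2 μ ℂ f) =
      ContinuousMap.toLp 2 μ ℂ (f.comp (ContinuousMap.mulLeft x)) :=
  rfl

theorem compositionOperator_toLp (γ : G →ₜ* G) (hγ : Function.Surjective γ) (f : C(G, ℂ)) :
    compositionOperator μ γ hγ (ContinuousMap.toLp 2 μ ℂ f) =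
      ContinuousMap.toLp 2 μ ℂ (f.comp (γ : C(G, G))) :=
  rfl

theorem translationOperator_one : translationOperator μ (1 : G) = 1 := by
  ext1 f
  have h : ((1 : G) * ·) = id := by ext; simp
  change Lp.compMeasurePreserving ((1 : G) * ·) (measurePreserving_mul_left μ 1) f = f
  simp only [h]
  exact Lp.compMeasurePreserving_id_apply f

theorem translationOperator_mul (x y : G) :
    translationOperator μ (x * y) = translationOperator μ x * translationOperator μ y := by
  ext1 f
  have h : ((x * y) * ·) = (y * ·) ∘ (x * ·) := by ext; simp; ac_rfl
  change Lp.compMeasurePreserving ((x * y) * ·) (measurePreserving_mul_left μ (x * y)) f = _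
  simp only [h]
  exact Lp.compMeasurePreserving_comp_apply f (measurePreserving_mul_left μ y)
    (measurePreserving_mul_left μ x)

theorem adjoint_translationOperator (x : G) :
    ContinuousLinearMap.adjoint (translationOperator μ x) = translationOperator μ x⁻¹ := by
  symm
  rw [ContinuousLinearMap.eq_adjoint_iff]
  intro f g
  have h := (Lp.compMeasurePreservingₗᵢ ℂ (x * ·) (measurePreserving_mul_left μ x)).inner_map_map
    (𝕜 := ℂ) (E := Lp ℂ 2 μ) (translationOperator μ x⁻¹ f) g
  rw [← h]
  change inner ℂ ((translationOperator μ x * translationOperator μ x⁻¹) f) _ = _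
  rw [← translationOperator_mul, mul_inv_cancel, translationOperator_one]
  rfl

theorem continuous_translationOperator_apply [μ.Regular] (f : Lp ℂ 2 μ) :
    Continuous fun x : G ↦ translationOperator μ x f := by
  let g : C(G, C(G, G)) := (ContinuousMap.mk (fun a : G × G ↦ a.1 * a.2) continuous_mul).curry
  exact (continuous_const (y := f)).compMeasurePreservingLp g.continuous
    (fun x ↦ measurePreserving_mul_left μ x) (by simp)

variable [μ.Regular] [IsProbabilityMeasure μ]

theorem integrable_smul_translationOperator (f : C(G, ℂ)) (ψ : Lp ℂ 2 μ) :
    Integrable (fun y ↦ f y • translationOperator μ y ψ) μ :=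
  (f.continuous.smul (continuous_translationOperator_apply μ ψ)).integrable_of_hasCompactSupport
    (HasCompactSupport.of_compactSpace _)

/-- The convolution operator `∫ f y • U y dμ(y)`, where `U` is the translation representation. -/
def convolutionOperator (f : C(G, ℂ)) : Lp ℂ 2 μ →L[ℂ] Lp ℂ 2 μ :=
  LinearMap.mkContinuous
    { toFun := fun ψ ↦ ∫ y, f y • translationOperator μ y ψ ∂μ
      map_add' := fun ψ φ ↦ by
        simp only [map_add, smul_add]
        exact integral_add (integrable_smul_translationOperator μ f ψ)
          (integrable_smul_translationOperator μ f φ)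
      map_smul' := fun c ψ ↦ by
        simp only [map_smul, RingHom.id_apply, smul_comm _ c]
        exact integral_smul c _ } ‖f‖ fun ψ ↦ by
    have h := norm_integral_le_of_norm_le_const (μ := μ) (C := ‖f‖ * ‖ψ‖)
      (f := fun y ↦ f y • translationOperator μ y ψ) (.of_forall fun y ↦ by
        rw [norm_smul, norm_translationOperator_apply]
        gcongr
        exact f.norm_coe_le_norm y)
    simpa using h

theorem convolutionOperator_apply (f : C(G, ℂ)) (ψ : Lp ℂ 2 μ) :
    convolutionOperator μ f ψ = ∫ y, f y • translationOperator μ y ψ ∂μ :=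
  rfl

theorem norm_convolutionOperator_le (f : C(G, ℂ)) : ‖convolutionOperator μ f‖ ≤ ‖f‖ :=
  LinearMap.mkContinuous_norm_le _ (norm_nonneg f) _

theorem convolutionOperator_sub (f g : C(G, ℂ)) :
    convolutionOperator μ (f - g) = convolutionOperator μ f - convolutionOperator μ g := by
  ext1 ψ
  simp only [sub_apply, convolutionOperator_apply, ContinuousMap.sub_apply,
    sub_smul]
  exact integral_sub (integrable_smul_translationOperator μ f ψ)
    (integrable_smul_translationOperator μ g ψ)

theorem commute_convolutionOperator (f : C(G, ℂ)) {A : Lp ℂ 2 μ →L[ℂ] Lp ℂ 2 μ}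
    (hA : ∀ x, Commute A (translationOperator μ x)) : Commute A (convolutionOperator μ f) := by
  ext1 ψ
  change A (∫ y, f y • translationOperator μ y ψ ∂μ) = ∫ y, f y • translationOperator μ y (A ψ) ∂μ
  rw [← A.integral_comp_comm (integrable_smul_translationOperator μ f ψ)]
  refine integral_congr_ae (.of_forall fun y ↦ ?_)
  change A (f y • translationOperator μ y ψ) = _
  rw [map_smul]
  exact congrArg (f y • ·) (congrArg (fun B : Lp ℂ 2 μ →L[ℂ] Lp ℂ 2 μ ↦ B ψ) (hA y).eq)

theorem translationOperator_mul_convolutionOperator (x : G) (f : C(G, ℂ)) :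
    translationOperator μ x * convolutionOperator μ f =
      convolutionOperator μ (f.comp (ContinuousMap.mulLeft x⁻¹)) := by
  ext1 ψ
  change translationOperator μ x (∫ y, f y • translationOperator μ y ψ ∂μ) =
    ∫ y, f (x⁻¹ * y) • translationOperator μ y ψ ∂μ
  rw [← ContinuousLinearMap.integral_comp_comm _ (integrable_smul_translationOperator μ f ψ),
    ← integral_mul_left_eq_self (fun y ↦ f (x⁻¹ * y) • translationOperator μ y ψ) x]
  refine integral_congr_ae (.of_forall fun y ↦ ?_)
  simp [translationOperator_mul]

/-- Translations alone are only shown to be strongly continuous. Multiplying by a convolution moves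
the translation onto `f`, and convolution is 1-Lipschitz from the sup norm to the operator norm. -/
theorem continuous_translationOperator_mul_convolutionOperator (f : C(G, ℂ)) :
    Continuous fun x : G ↦ translationOperator μ x * convolutionOperator μ f := by
  simp only [translationOperator_mul_convolutionOperator]
  have h : Continuous (convolutionOperator μ) := by
    refine (LipschitzWith.of_dist_le_mul (K := 1) fun f g ↦ ?_).continuous
    rw [dist_eq_norm, dist_eq_norm, ← convolutionOperator_sub]
    simpa using norm_convolutionOperator_le μ (f - g)
  let F : C(G, C(G, ℂ)) := (ContinuousMap.mk (fun a : G × G ↦ f (a.1⁻¹ * a.2))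
    (by fun_prop)).curry
  exact h.comp F.continuous

/-- For `f y = conj ⟨ψ, U y ψ⟩`, the inner product of `ψ` with its convolution is `∫ |⟨ψ, U y ψ⟩|²
dμ`, whose continuous integrand is nonzero at `y = 1`. -/
theorem exists_convolutionOperator_apply_ne_zero {ψ : Lp ℂ 2 μ} (hψ : ψ ≠ 0) :
    ∃ f : C(G, ℂ), convolutionOperator μ f ψ ≠ 0 := by
  have hc : Continuous fun y ↦ inner ℂ ψ (translationOperator μ y ψ) :=
    continuous_const.inner (continuous_translationOperator_apply μ ψ)
  refine ⟨⟨fun y ↦ star (inner ℂ ψ (translationOperator μ y ψ)), hc.star⟩, fun h ↦ ?_⟩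
  have h₁ := congrArg (fun φ ↦ inner ℂ ψ φ) h
  simp only [inner_zero_right, convolutionOperator_apply] at h₁
  rw [← integral_inner (integrable_smul_translationOperator μ _ ψ)] at h₁
  have h₂ : ∫ y, ‖inner ℂ ψ (translationOperator μ y ψ)‖ ^ 2 ∂μ = 0 := by
    rw [← Complex.ofReal_eq_zero, ← integral_complex_ofReal, ← h₁]
    refine integral_congr_ae (.of_forall fun y ↦ ?_)
    simp only [inner_smul_right, ContinuousMap.coe_mk]
    rw [Complex.ofReal_pow]
    exact (RCLike.conj_mul _).symm
  have h₃ : Continuous fun y ↦ ‖inner ℂ ψ (translationOperator μ y ψ)‖ ^ 2 := hc.norm.pow 2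
  rw [integral_eq_zero_iff_of_nonneg (fun y ↦ by positivity)
    (h₃.integrable_of_hasCompactSupport (HasCompactSupport.of_compactSpace _)),
    h₃.ae_eq_iff_eq μ continuous_zero] at h₂
  have h₄ := congrFun h₂ 1
  simp [translationOperator_one, hψ] at h₄

end Translation

/-! ### Characters separate points, by Gelfand duality -/

section Separation

/-- A unitary representation of a group in a commutative C⋆-algebra yields characters. -/
theorem exists_pontryaginDual_apply_ne_one_of_monoidHom {G A : Type*} [CommGroup G]
    [TopologicalSpace G] [CommCStarAlgebra A] (U : G →* A) (hU : ∀ x, star (U x) = U x⁻¹) {C : A}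
    (hC : Continuous fun x ↦ U x * C) {k : G} (hk : C * (U k - 1) ≠ 0) :
    ∃ χ : PontryaginDual G, χ k ≠ 1 := by
  obtain ⟨φ, hφ⟩ : ∃ φ : WeakDual.characterSpace ℂ A, φ (C * (U k - 1)) ≠ 0 := by
    by_contra! h
    refine hk ((gelfandTransform_isometry A).injective ?_)
    rw [map_zero]
    ext φ
    exact h φ
  rw [map_mul, map_sub, map_one, mul_ne_zero_iff, sub_ne_zero] at hφ
  have hnorm (x : G) : φ (U x) ∈ Submonoid.unitSphere ℂ := by
    have h : star (φ (U x)) * φ (U x) = 1 := by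
      rw [← map_star, ← map_mul, hU, ← map_mul, inv_mul_cancel, map_one, map_one]
    have h' := congrArg norm h
    rw [norm_mul, norm_star, norm_one] at h'
    refine mem_sphere_zero_iff_norm.2 ?_
    nlinarith [norm_nonneg (φ (U x))]
  -- Since `φ C ≠ 0`, `φ (U x) = φ (U x * C) / φ C`, so norm continuity of `U x * C` suffices.
  have hcont : Continuous fun x ↦ φ (U x) := by
    convert ((map_continuous φ).comp hC).div_const (φ C) using 2 with x
    rw [Function.comp_apply, map_mul, mul_div_cancel_right₀ _ hφ.1]
  let χ : G →ₜ* Circle :=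
    { toFun := fun x ↦ ⟨φ (U x), hnorm x⟩
      map_one' := Subtype.ext (by simp)
      map_mul' := fun x y ↦ Subtype.ext <| by
        change φ (U (x * y)) = φ (U x) * φ (U y)
        rw [map_mul, map_mul]
      continuous_toFun := hcont.subtype_mk _ }
  exact ⟨χ, fun h ↦ hφ.2 (congrArg Subtype.val h)⟩

variable {G : Type*} [CommGroup G] [TopologicalSpace G] [IsTopologicalGroup G] [CompactSpace G]
  [T2Space G]

theorem exists_translationOperator_ne_one [MeasurableSpace G] [BorelSpace G] (μ : Measure G)
    [μ.IsHaarMeasure] {k : G} (hk : k ≠ 1) : translationOperator μ k ≠ 1 := by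
  intro h
  obtain ⟨f, hf₀, hf₁, -⟩ := exists_continuous_zero_one_of_isClosed (isClosed_singleton (x := k))
    (isClosed_singleton (x := (1 : G))) (by simpa using hk)
  let F : C(G, ℂ) := ⟨fun x ↦ (f x : ℂ), by fun_prop⟩
  have h₁ : translationOperator μ k (ContinuousMap.toLp 2 μ ℂ F) = ContinuousMap.toLp 2 μ ℂ F := by
    rw [h]; rfl
  rw [translationOperator_toLp] at h₁
  have h₂ := DFunLike.congr_fun (ContinuousMap.toLp_injective μ h₁) 1
  simp [F, hf₀ rfl, hf₁ rfl] at h₂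

/-- The von Neumann algebra generated by the translations of `L²(G, μ)`. -/
abbrev translationAlgebra [MeasurableSpace G] [BorelSpace G] (μ : Measure G) [μ.IsHaarMeasure] :
    StarSubalgebra ℂ (Lp ℂ 2 μ →L[ℂ] Lp ℂ 2 μ) :=
  StarSubalgebra.centralizer ℂ
    (StarSubalgebra.centralizer ℂ (Set.range (translationOperator μ)) :
      Set (Lp ℂ 2 μ →L[ℂ] Lp ℂ 2 μ))

section

variable [MeasurableSpace G] [BorelSpace G] (μ : Measure G) [μ.IsHaarMeasure]

theorem translationOperator_mem_translationAlgebra (x : G) :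
    translationOperator μ x ∈ translationAlgebra μ :=
  StarAlgebra.adjoin_le_centralizer_centralizer ℂ _
    (StarAlgebra.subset_adjoin ℂ _ (Set.mem_range_self x))

/-- An integral of translations commutes with whatever commutes with every translation, so the
bicommutant contains it without any approximation by sums. -/
theorem convolutionOperator_mem_translationAlgebra [μ.Regular] [IsProbabilityMeasure μ]
    (f : C(G, ℂ)) : convolutionOperator μ f ∈ translationAlgebra μ := by
  rw [StarSubalgebra.mem_centralizer_iff]
  have key : ∀ A ∈ StarSubalgebra.centralizer ℂ (Set.range (translationOperator μ)),
      A * convolutionOperator μ f = convolutionOperator μ f * A := fun A hA ↦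
    commute_convolutionOperator μ f fun x ↦
      ((StarSubalgebra.mem_centralizer_iff ℂ).1 hA _ (Set.mem_range_self x)).1.symm
  exact fun A hA ↦ ⟨key A hA, key _ (star_mem hA)⟩

theorem translationAlgebra_mul_comm (A B : translationAlgebra μ) : A * B = B * A := by
  -- The set of translations is closed under adjoints, so the star-centralizer is the plain one.
  have hle : (translationAlgebra μ : Set (Lp ℂ 2 μ →L[ℂ] Lp ℂ 2 μ)) =
      (Set.range (translationOperator μ)).centralizer.centralizer := by
    rw [StarSubalgebra.coe_centralizer_centralizer]
    congr 2
    rw [Set.union_eq_left]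
    rintro A ⟨x, hx⟩
    refine ⟨x⁻¹, ?_⟩
    rw [← adjoint_translationOperator, hx]
    exact star_star A
  refine Subtype.ext (Set.centralizer_centralizer_comm_of_comm ?_ _ (hle.subset A.2) _
    (hle.subset B.2))
  rintro _ ⟨x, rfl⟩ _ ⟨y, rfl⟩
  rw [← translationOperator_mul, ← translationOperator_mul, mul_comm]

instance : IsClosed (translationAlgebra μ : Set (Lp ℂ 2 μ →L[ℂ] Lp ℂ 2 μ)) := by
  rw [StarSubalgebra.coe_centralizer]
  exact Set.isClosed_centralizer _

instance : CommCStarAlgebra (translationAlgebra μ) where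
  mul_comm := translationAlgebra_mul_comm μ

end

/-- The continuous characters of a compact abelian group separate its points. -/
theorem PontryaginDual.exists_apply_ne_one {k : G} (hk : k ≠ 1) :
    ∃ χ : PontryaginDual G, χ k ≠ 1 := by
  borelize G
  let μ : Measure G := Measure.haarMeasure ⊤
  have : IsProbabilityMeasure μ :=
    ⟨by simpa using Measure.haarMeasure_self (K₀ := (⊤ : TopologicalSpace.PositiveCompacts G))⟩
  obtain ⟨ψ, hψ⟩ : ∃ ψ, (translationOperator μ k - 1) ψ ≠ 0 := by
    by_contra! h
    exact exists_translationOperator_ne_one μ hk (sub_eq_zero.1 (ContinuousLinearMap.ext h))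
  -- Applied to the vector `(U k - 1) ψ`, so that `C * (U k - 1) ≠ 0` for the convolution `C` by
  -- `f`.
  obtain ⟨f, hf⟩ := exists_convolutionOperator_apply_ne_zero μ hψ
  let U : G →* translationAlgebra μ :=
    { toFun := fun x ↦ ⟨_, translationOperator_mem_translationAlgebra μ x⟩
      map_one' := Subtype.ext (translationOperator_one μ)
      map_mul' := fun x y ↦ Subtype.ext (translationOperator_mul μ x y) }
  refine exists_pontryaginDual_apply_ne_one_of_monoidHom U
    (fun x ↦ Subtype.ext (adjoint_translationOperator μ x))
    (C := ⟨_, convolutionOperator_mem_translationAlgebra μ f⟩) ?_ fun h ↦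
      hf (congrArg (fun A : translationAlgebra μ ↦ (A : Lp ℂ 2 μ →L[ℂ] Lp ℂ 2 μ) ψ) h)
  exact (continuous_translationOperator_mul_convolutionOperator μ f).subtype_mk _

end Separation

end

/-! ### Characters, kernels and closed subgroups -/

section Characters

variable {G : Type*} [CommGroup G] [TopologicalSpace G] [IsTopologicalGroup G] [CompactSpace G]
  [T2Space G]

theorem isQuotientMap_of_surjective {γ : G →ₜ* G} (hγ : Function.Surjective γ) :
    Topology.IsQuotientMap (γ : C(G, G)) :=
  (map_continuous γ).isClosedMap.isQuotientMap (map_continuous γ) hγ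

theorem factorsThrough_of_forall_ker_mul {γ : G →ₜ* G} {X : Type*} {f : G → X}
    (hf : ∀ k ∈ (γ : G →* G).ker, ∀ x, f (k * x) = f x) : Function.FactorsThrough f γ := by
  intro x y h
  have hk : x * y⁻¹ ∈ (γ : G →* G).ker := by
    change γ (x * y⁻¹) = 1
    rw [map_mul, map_inv, h, mul_inv_cancel]
  simpa using hf _ hk y

/-- A character trivial on the kernel descends along `γ`; the descended map is continuous because
`γ`, a continuous surjection between compact Hausdorff spaces, is a quotient map. -/
theorem pontryaginDual_mem_range_map_iff {γ : G →ₜ* G} (hγ : Function.Surjective γ)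
    (χ : PontryaginDual G) :
    χ ∈ Set.range (PontryaginDual.map γ) ↔ ∀ k ∈ (γ : G →* G).ker, χ k = 1 := by
  constructor
  · rintro ⟨ψ, rfl⟩ k hk
    have hk' : γ k = 1 := hk
    rw [PontryaginDual.map_apply, hk', map_one]
  · intro h
    let q := isQuotientMap_of_surjective hγ
    have hfac : Function.FactorsThrough χ γ :=
      factorsThrough_of_forall_ker_mul fun k hk x ↦ by simp [h k hk]
    let f : C(G, Circle) := q.lift ⟨χ, map_continuous χ⟩ hfac
    have hf (x : G) : f (γ x) = χ x :=
      DFunLike.congr_fun (q.lift_comp ⟨χ, map_continuous χ⟩ hfac) x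
    let ψ : G →ₜ* Circle :=
      { toFun := f
        map_one' := by rw [← map_one γ, hf, map_one]
        map_mul' := fun x y ↦ by
          obtain ⟨x, rfl⟩ := hγ x
          obtain ⟨y, rfl⟩ := hγ y
          rw [← map_mul, hf, hf, hf, map_mul]
        continuous_toFun := f.continuous }
    exact ⟨ψ, PontryaginDual.ext hf⟩

/-- Separate points in the compact Hausdorff group `G ⧸ N` and pull back. -/
theorem pontryaginDual_exists_apply_ne_one_of_notMem {N : Subgroup G} (hN : IsClosed (N : Set G))
    {k : G} (hk : k ∉ N) : ∃ χ : PontryaginDual G, (∀ x ∈ N, χ x = 1) ∧ χ k ≠ 1 := by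
  obtain ⟨χ, hχ⟩ := PontryaginDual.exists_apply_ne_one (G := G ⧸ N) (k := k)
    (by rwa [Ne, QuotientGroup.eq_one_iff])
  let π : G →ₜ* G ⧸ N :=
    { toMonoidHom := QuotientGroup.mk' N
      continuous_toFun := QuotientGroup.continuous_mk }
  refine ⟨PontryaginDual.map π χ, fun x hx ↦ ?_, hχ⟩
  rw [PontryaginDual.map_apply, show π x = 1 from (QuotientGroup.eq_one_iff x).2 hx,
    map_one]

end Characters

/-! ### Commuting endomorphisms and a finite kernel -/

section Kernel

theorem MonoidHom.map_mem_ker_of_comm {G : Type*} [Group G] {f g : G →* G}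
    (h : ∀ x, f (g x) = g (f x)) {x : G} (hx : x ∈ f.ker) : g x ∈ f.ker := by
  rw [MonoidHom.mem_ker] at hx ⊢
  rw [h, hx, map_one]

/-- By commutation `g` restricts to a self-map of the finite group `f.ker`; the two sides are its
injectivity and its surjectivity. -/
theorem MonoidHom.ker_inf_ker_eq_bot_iff_le_map {G : Type*} [Group G] {f g : G →* G}
    (h : ∀ x, f (g x) = g (f x)) [Finite f.ker] :
    f.ker ⊓ g.ker = ⊥ ↔ f.ker ≤ f.ker.map g := by
  let r : f.ker →* f.ker := (g.comp f.ker.subtype).codRestrict f.ker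
    fun x ↦ map_mem_ker_of_comm h x.2
  have h₁ : Function.Injective r ↔ f.ker ⊓ g.ker = ⊥ := by
    rw [injective_iff_map_eq_one, Subgroup.eq_bot_iff_forall]
    constructor
    · exact fun hr x hx ↦ congrArg Subtype.val (hr ⟨x, hx.1⟩ (Subtype.ext hx.2))
    · exact fun hr x hx ↦ Subtype.ext (hr x ⟨x.2, congrArg Subtype.val hx⟩)
  have h₂ : Function.Surjective r ↔ f.ker ≤ f.ker.map g := by
    constructor
    · intro hr x hx
      obtain ⟨y, hy⟩ := hr ⟨x, hx⟩
      exact ⟨y, y.2, congrArg Subtype.val hy⟩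
    · rintro hr ⟨x, hx⟩
      obtain ⟨y, hy, hyx⟩ := hr hx
      exact ⟨⟨y, hy⟩, Subtype.ext hyx⟩
  rw [← h₁, ← h₂]
  exact Finite.injective_iff_surjective

end Kernel

/-! ### Composition and transfer operators as averages over the kernel -/

section Operators

variable {G : Type*} [CommGroup G] [TopologicalSpace G] [IsTopologicalGroup G] [CompactSpace G]
  [T2Space G] [MeasurableSpace G] [BorelSpace G] (μ : Measure G) [μ.IsHaarMeasure]

theorem compositionOperator_injective {γ : G →ₜ* G} (hγ : Function.Surjective γ) :
    Function.Injective (compositionOperator μ γ hγ) :=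
  (Lp.isometry_compMeasurePreserving (measurePreserving_of_surjective μ γ hγ)).injective

theorem transferOperator_mul_compositionOperator {γ : G →ₜ* G} (hγ : Function.Surjective γ) :
    transferOperator μ γ hγ * compositionOperator μ γ hγ = 1 := by
  refine ContinuousLinearMap.ext fun f ↦ ext_inner_right ℂ fun g ↦ ?_
  change inner ℂ (ContinuousLinearMap.adjoint (compositionOperator μ γ hγ)
    (compositionOperator μ γ hγ f)) g = inner ℂ f g
  rw [ContinuousLinearMap.adjoint_inner_left]
  exact (Lp.compMeasurePreservingₗᵢ ℂ γ (measurePreserving_of_surjective μ γ hγ)).inner_map_map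
    (𝕜 := ℂ) (E := Lp ℂ 2 μ) f g

theorem compositionOperator_comm {γ₁ γ₂ : G →ₜ* G} (hcomm : ∀ x, γ₁ (γ₂ x) = γ₂ (γ₁ x))
    (hγ₁ : Function.Surjective γ₁) (hγ₂ : Function.Surjective γ₂) :
    compositionOperator μ γ₁ hγ₁ * compositionOperator μ γ₂ hγ₂ =
      compositionOperator μ γ₂ hγ₂ * compositionOperator μ γ₁ hγ₁ := by
  ext1 f
  have h₁ := measurePreserving_of_surjective μ γ₁ hγ₁
  have h₂ := measurePreserving_of_surjective μ γ₂ hγ₂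
  have h : (γ₂ : G → G) ∘ γ₁ = γ₁ ∘ γ₂ := funext fun x ↦ (hcomm x).symm
  refine (Lp.compMeasurePreserving_comp_apply f h₂ h₁).symm.trans ?_
  simp only [h]
  exact Lp.compMeasurePreserving_comp_apply f h₁ h₂

theorem translationOperator_mul_compositionOperator {γ : G →ₜ* G} (hγ : Function.Surjective γ)
    (x : G) : translationOperator μ x * compositionOperator μ γ hγ =
      compositionOperator μ γ hγ * translationOperator μ (γ x) := by
  ext1 f
  have h₁ := measurePreserving_of_surjective μ γ hγ
  have h : (γ : G → G) ∘ (x * ·) = (γ x * ·) ∘ γ := funext fun y ↦ map_mul γ x y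
  refine (Lp.compMeasurePreserving_comp_apply f h₁ (measurePreserving_mul_left μ x)).symm.trans ?_
  simp only [h]
  exact Lp.compMeasurePreserving_comp_apply f (measurePreserving_mul_left μ (γ x)) h₁

theorem adjoint_sum_translationOperator (K : Subgroup G) [Fintype K] :
    ContinuousLinearMap.adjoint (∑ k : K, translationOperator μ (k : G)) =
      ∑ k : K, translationOperator μ (k : G) := by
  rw [map_sum]
  simp only [adjoint_translationOperator]
  exact Fintype.sum_equiv (Equiv.inv K) _ _ fun k ↦ by simp

theorem sum_translationOperator_toLp {ι : Type*} [Fintype ι] (u : ι → G) (f : C(G, ℂ)) :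
    (∑ i, translationOperator μ (u i)) (ContinuousMap.toLp 2 μ ℂ f) =
      ContinuousMap.toLp 2 μ ℂ (∑ i, f.comp (ContinuousMap.mulLeft (u i))) := by
  rw [sum_apply, map_sum]
  rfl

/-- Up to normalization, `T_γ Π_γ` is the averaging operator over the kernel of `γ`. -/
theorem sum_translationOperator_ker [μ.Regular] {γ : G →ₜ* G} (hγ : Function.Surjective γ)
    [Fintype (γ : G →* G).ker] :
    ∑ k : (γ : G →* G).ker, translationOperator μ (k : G) =
      (Fintype.card (γ : G →* G).ker : ℂ) • (compositionOperator μ γ hγ * transferOperator μ γ hγ) := by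
  set T := compositionOperator μ γ hγ
  set Q := transferOperator μ γ hγ
  set S := ∑ k : (γ : G →* G).ker, translationOperator μ (k : G)
  have hST : S * T = (Fintype.card (γ : G →* G).ker : ℂ) • T := by
    rw [Finset.sum_mul, Finset.sum_congr rfl (g := fun _ ↦ T), Finset.sum_const, Finset.card_univ,
      Nat.cast_smul_eq_nsmul]
    intro k _
    rw [translationOperator_mul_compositionOperator, show γ (k : G) = 1 from k.2,
      translationOperator_one, mul_one]
  -- On the dense set of continuous `f`, `S f` is invariant under the kernel, hence lies in the
  -- range of `T`, where `T * Q` is the identity because `Q * T = 1`.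
  have hPS : T * Q * S = S := by
    refine ContinuousLinearMap.ext fun φ ↦ ?_
    refine (ContinuousMap.toLp_denseRange ℂ μ ℂ (p := 2) (by simp)).induction_on φ
      (isClosed_eq (ContinuousLinearMap.continuous _) (ContinuousLinearMap.continuous _))
      fun f ↦ ?_
    let F : C(G, ℂ) := ∑ k : (γ : G →* G).ker, f.comp (ContinuousMap.mulLeft (k : G))
    have hF (x : G) : F x = ∑ k : (γ : G →* G).ker, f (k * x) := by
      simp [F, ContinuousMap.sum_apply]
    let q := isQuotientMap_of_surjective hγ
    have hfac : Function.FactorsThrough F γ := factorsThrough_of_forall_ker_mul fun k hk x ↦ by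
      rw [hF, hF]
      exact Fintype.sum_equiv (Equiv.mulRight ⟨k, hk⟩) _ _ fun l ↦ by simp [mul_assoc]
    have hS : S (ContinuousMap.toLp 2 μ ℂ f) = T (ContinuousMap.toLp 2 μ ℂ (q.lift F hfac)) := by
      rw [compositionOperator_toLp, sum_translationOperator_toLp]
      exact congrArg _ (q.lift_comp F hfac).symm
    change T (Q (S _)) = S _
    rw [hS]
    exact congrArg (fun A : Lp ℂ 2 μ →L[ℂ] Lp ℂ 2 μ ↦ T (A _))
      (transferOperator_mul_compositionOperator μ hγ)
  -- Take adjoints: both `S` and `T * Q` are self-adjoint.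
  have hSP : S * (T * Q) = S := by
    have hS : star S = S := adjoint_sum_translationOperator μ _
    have hQ : Q = star T := rfl
    have h := congrArg star hPS
    rwa [star_mul, star_mul, hS, hQ, star_star, ← hQ] at h
  rw [← hSP, ← mul_assoc, hST, smul_mul_assoc]

variable {γ₁ γ₂ : G →ₜ* G}

theorem comp_transferOperator_eq_iff [μ.Regular] (hcomm : ∀ x, γ₁ (γ₂ x) = γ₂ (γ₁ x))
    (hγ₁ : Function.Surjective γ₁) (hγ₂ : Function.Surjective γ₂)
    [Fintype (γ₁ : G →* G).ker] :
    (compositionOperator μ γ₂ hγ₂).comp (transferOperator μ γ₁ hγ₁) =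
        (transferOperator μ γ₁ hγ₁).comp (compositionOperator μ γ₂ hγ₂) ↔
      ∑ k : (γ₁ : G →* G).ker, translationOperator μ (k : G) =
        ∑ k : (γ₁ : G →* G).ker, translationOperator μ (γ₂ k) := by
  have hT := compositionOperator_comm μ hcomm hγ₁ hγ₂
  have hS := sum_translationOperator_ker μ hγ₁
  have hTS : (∑ k : (γ₁ : G →* G).ker, translationOperator μ (k : G)) *
      compositionOperator μ γ₂ hγ₂ = compositionOperator μ γ₂ hγ₂ *
        ∑ k : (γ₁ : G →* G).ker, translationOperator μ (γ₂ k) := by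
    simp only [Finset.sum_mul, Finset.mul_sum, translationOperator_mul_compositionOperator]
  have hcancel {γ : G →ₜ* G} (hγ : Function.Surjective γ) (A B : Lp ℂ 2 μ →L[ℂ] Lp ℂ 2 μ) :
      compositionOperator μ γ hγ * A = compositionOperator μ γ hγ * B ↔ A = B :=
    ⟨fun h ↦ ContinuousLinearMap.ext fun f ↦ compositionOperator_injective μ hγ
      (congrArg (fun C : Lp ℂ 2 μ →L[ℂ] Lp ℂ 2 μ ↦ C f) h), fun h ↦ h ▸ rfl⟩
  -- Multiplied by `T_{γ₂}` on the left, equality of the sums says that `T_{γ₂}` commutes with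
  -- `T_{γ₁} Π_{γ₁}`; then `T_{γ₁}` is moved to the front and cancelled.
  rw [← hcancel hγ₂ (∑ k : (γ₁ : G →* G).ker, translationOperator μ (k : G)), ← hTS, hS, mul_smul_comm, smul_mul_assoc,
    smul_right_inj (Nat.cast_ne_zero.2 Fintype.card_ne_zero), ← mul_assoc, ← hT, mul_assoc, mul_assoc, hcancel hγ₁]
  rfl

theorem sum_translationOperator_eq_iff (hcomm : ∀ x, γ₁ (γ₂ x) = γ₂ (γ₁ x))
    [Fintype (γ₁ : G →* G).ker] :
    ∑ k : (γ₁ : G →* G).ker, translationOperator μ (k : G) =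
        ∑ k : (γ₁ : G →* G).ker, translationOperator μ (γ₂ k) ↔
      (γ₁ : G →* G).ker ≤ (γ₁ : G →* G).ker.map (γ₂ : G →* G) := by
  constructor
  · intro h k hk
    by_contra hk'
    have hclosed : IsClosed ((γ₁ : G →* G).ker.map (γ₂ : G →* G) : Set G) :=
      ((Set.toFinite ((γ₁ : G →* G).ker : Set G)).image γ₂).isClosed
    -- Apply both sums to `f` and evaluate at `1`: the sum over `γ₂ l` vanishes, while the other has
    -- nonnegative terms, one of them `f k = 1`.
    obtain ⟨f, hf₀, hf₁, hf⟩ := exists_continuous_zero_one_of_isClosed hclosed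
      (isClosed_singleton (x := k)) (Set.disjoint_singleton_right.2 hk')
    let F : C(G, ℂ) := ⟨fun x ↦ (f x : ℂ), by fun_prop⟩
    have h₁ := congrArg (fun A : Lp ℂ 2 μ →L[ℂ] Lp ℂ 2 μ ↦ A (ContinuousMap.toLp 2 μ ℂ F)) h
    simp only [sum_translationOperator_toLp] at h₁
    have h₂ := DFunLike.congr_fun (ContinuousMap.toLp_injective μ h₁) 1
    simp only [ContinuousMap.sum_apply, ContinuousMap.comp_apply, ContinuousMap.coe_mulLeft,
      mul_one, F, ContinuousMap.coe_mk] at h₂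
    norm_cast at h₂
    rw [Finset.sum_eq_zero (f := fun l : (γ₁ : G →* G).ker ↦ f (γ₂ l))
      fun l _ ↦ hf₀ ⟨l, l.2, rfl⟩, 
      Finset.sum_eq_zero_iff_of_nonneg (f := fun l : (γ₁ : G →* G).ker ↦ f l)
      fun l _ ↦ (hf l).1] at h₂
    simpa [hf₁ rfl] using h₂ ⟨k, hk⟩ (Finset.mem_univ _)
  · intro h
    -- A surjective self-map of the finite kernel is a permutation, so it only reindexes the sum.
    let r : (γ₁ : G →* G).ker → (γ₁ : G →* G).ker :=
      fun k ↦ ⟨γ₂ k, MonoidHom.map_mem_ker_of_comm (f := (γ₁ : G →* G)) (g := γ₂) hcomm k.2⟩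
    have hr : Function.Surjective r := fun ⟨k, hk⟩ ↦ by
      obtain ⟨l, hl, hlk⟩ := h hk
      exact ⟨⟨l, hl⟩, Subtype.ext hlk⟩
    exact ((Equiv.ofBijective r (Finite.surjective_iff_bijective.1 hr)).sum_comp
      fun k ↦ translationOperator μ (k : G)).symm

end Operators

theorem forall_map_mem_range_iff {G : Type*} [CommGroup G] [TopologicalSpace G]
    [IsTopologicalGroup G] [CompactSpace G] [T2Space G] {γ₁ : G →ₜ* G} (γ₂ : G →ₜ* G)
    (hγ₁ : Function.Surjective γ₁) [Finite (γ₁ : G →* G).ker] :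
    (∀ χ : PontryaginDual G, PontryaginDual.map γ₂ χ ∈ Set.range (PontryaginDual.map γ₁) →
        χ ∈ Set.range (PontryaginDual.map γ₁)) ↔
      (γ₁ : G →* G).ker ≤ (γ₁ : G →* G).ker.map (γ₂ : G →* G) := by
  simp only [pontryaginDual_mem_range_map_iff hγ₁, PontryaginDual.map_apply]
  constructor
  · intro h k hk
    by_contra hk'
    have hclosed : IsClosed ((γ₁ : G →* G).ker.map (γ₂ : G →* G) : Set G) :=
      ((Set.toFinite ((γ₁ : G →* G).ker : Set G)).image γ₂).isClosed
    obtain ⟨χ, hχ, hχk⟩ := pontryaginDual_exists_apply_ne_one_of_notMem hclosed hk'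
    exact hχk (h χ (fun l hl ↦ hχ _ ⟨l, hl, rfl⟩) k hk)
  · intro h χ hχ k hk
    obtain ⟨l, hl, rfl⟩ := h hk
    exact hχ l hl

theorem proposition4p1 {G : Type*} [CommGroup G] [TopologicalSpace G] [IsTopologicalGroup G]
    [CompactSpace G] [T2Space G] [MeasurableSpace G] [BorelSpace G]
    (μ : Measure G) [μ.IsHaarMeasure] [μ.Regular] [IsProbabilityMeasure μ]
    (γ₁ γ₂ : G →ₜ* G) (hcomm : ∀ x : G, γ₁ (γ₂ x) = γ₂ (γ₁ x))
    (hγ₁ : Function.Surjective γ₁) (hγ₂ : Function.Surjective γ₂)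
    (hker : Finite (γ₁ : G →* G).ker) :
    List.TFAE
      [(compositionOperator μ γ₂ hγ₂).comp (transferOperator μ γ₁ hγ₁) =
          (transferOperator μ γ₁ hγ₁).comp (compositionOperator μ γ₂ hγ₂),
        ∀ χ : PontryaginDual G,
          PontryaginDual.map γ₂ χ ∈ Set.range (PontryaginDual.map γ₁) →
            χ ∈ Set.range (PontryaginDual.map γ₁),
        (γ₁ : G →* G).ker ⊓ (γ₂ : G →* G).ker = ⊥] := by
  have := Fintype.ofFinite (γ₁ : G →* G).ker
  have h₁ := (comp_transferOperator_eq_iff μ hcomm hγ₁ hγ₂).trans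
    (sum_translationOperator_eq_iff μ hcomm)
  have h₂ := forall_map_mem_range_iff γ₂ hγ₁
  have h₃ := MonoidHom.ker_inf_ker_eq_bot_iff_le_map (f := (γ₁ : G →* G)) (g := γ₂) hcomm
  tfae_have 1 ↔ 2 := h₁.trans h₂.symm
  tfae_have 2 ↔ 3 := h₂.trans h₃.symm
  tfae_finish
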